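/- Let $m\ge 1$, let $(\mathbb P,\sigma)$ be a compact connected smooth Riemannian manifold (without boundary) of dimension $m$, let $I\subseteq\mathbb R$ be a nonempty open interval, and let $h\in C^\infty(\mathbb P)$, $\rho\in C^\infty(I)$ be positive functions. Let $\overline M=I\times\mathbb P$ be the doubly warped product spacetime with the Lorentzian metric $\overline g_{(t,x)}=-h(x)^2\,\pi_I^*(dt^2)+\rho(t)^2\,\pi_{\mathbb P}^*(\sigma)$, time-oriented by $\partial_t$. A spacelike hypersurface of $\overline M$ is a smooth map $\psi:M\to\overline M$ from a nonempty smooth $m$-dimensional manifold $M$ such that $g=\psi^*\overline g$ is a Riemannian metric. Its second fundamental form is $\mathrm{II}(V,W)=\overline\nabla_VW-\nabla_VW$, where $\overline\nabla,\nabla$ are the Levi-Civita connections of $\overline g$ and $g$, and its mean curvature is $H=-\overline g\big(\tfrac1m\operatorname{trace}_g\mathrm{II},N\big)$, where $N$ is the future-pointing unit normal. It is maximal if $H\equiv0$ and totally geodesic if $\mathrm{II}\equiv0$. The slice at time $t\in I$ is $\Sigma_t=\{t\}\times\mathbb P$. Then $\overline M$ admits a compact maximal spacelike hypersurface if and only if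 it admits a totally geodesic spacelike slice; this holds both when hypersurfaces are allowed to be disconnected and when they are required to be connected. Moreover, for each $t_0\in I$, the slice $\Sigma_{t_0}$ is a totally geodesic spacelike hypersurface if and only if $\rho'(t_0)=0$. -/

import Mathlib

open Manifold
open scoped ContDiff

universe u v

noncomputable section

section PseudoRiemannian

variable {E : Type*} [NormedAddCommGroup E] [NormedSpace ℝ E]
  {H : Type*} [TopologicalSpace H] {I : ModelWithCorners ℝ E H}
  {N : Type*} [TopologicalSpace N] [ChartedSpace H N]
  {E' : Type*} [NormedAddCommGroup E'] [NormedSpace ℝ E']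
  {H' : Type*} [TopologicalSpace H'] {I' : ModelWithCorners ℝ E' H'}
  {M : Type*} [TopologicalSpace M] [ChartedSpace H' M]

/-- A field of bilinear forms on the tangent spaces of `N` (a `(0,2)`-tensor field). -/
abbrev BilinField (I : ModelWithCorners ℝ E H) (N : Type*) [TopologicalSpace N]
    [ChartedSpace H N] :=
  ∀ x : N, TangentSpace I x →L[ℝ] TangentSpace I x →L[ℝ] ℝ

/-- The pullback of a bilinear form on the vector space `E` under a linear map `E' → E`. -/
def pullbackForm (b : E →L[ℝ] E →L[ℝ] ℝ) (L : E' →L[ℝ] E) : E' →L[ℝ] E' →L[ℝ] ℝ :=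
  b.bilinearComp L L

/-- The pullback `f^* g` of a field of bilinear forms:
`(f^* g)_q (v, w) = g_{f q} (df_q v, df_q w)`. -/
def pullbackField (I' : ModelWithCorners ℝ E' H') (g : BilinField I N) (f : M → N) :
    BilinField I' M :=
  fun q ↦ pullbackForm (E := E) (E' := E') (g (f q)) (mfderiv I' I f q)

/-- The metric `g` in the preferred chart at `x₀`: the pullback of `g` to the model space `E` under
the inverse of the chart, as a function of the coordinates `u`. -/
def metricInChart (g : BilinField I N) (x₀ : N) (u : E) : E →L[ℝ] E →L[ℝ] ℝ :=
  pullbackForm (E := E) (E' := E) (g ((extChartAt I x₀).symm u))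
    (mfderiv 𝓘(ℝ, E) I (extChartAt I x₀).symm u)

/-- Christoffel symbols of the first kind at `x₀`, in the preferred chart at `x₀`:
`Γ(v, w; z) = (1/2) (∂_v g(w, z) + ∂_w g(v, z) - ∂_z g(v, w))`, as a linear form in `z`. -/
def christoffelFirst (g : BilinField I N) (x₀ : N) (v w : TangentSpace I x₀) : E →L[ℝ] ℝ :=
  let u : E := extChartAt I x₀ x₀
  let G : E → E →L[ℝ] E →L[ℝ] ℝ := metricInChart g x₀
  (1 / 2 : ℝ) • (fderiv ℝ (fun y ↦ G y w) u v + fderiv ℝ (fun y ↦ G y v) u w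
    - fderiv ℝ (fun y ↦ G y v w) u)

/-- Christoffel symbols of the second kind at `x₀`, in the preferred chart at `x₀`: the vector
`Γ(v, w)` with `g (Γ(v, w), z) = Γ(v, w; z)` for all `z`, for a nondegenerate metric `g`. It is the
Levi-Civita derivative at `x₀` of the coordinate field with constant components `w` in the
direction `v`. The identification of `TangentSpace I x₀` with `E` is the one given by the chart
at `x₀`. -/
def christoffel (g : BilinField I N) (x₀ : N) (v w : TangentSpace I x₀) : TangentSpace I x₀ :=
  (metricInChart g x₀ (extChartAt I x₀ x₀)).inverse (christoffelFirst g x₀ v w)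

/-- The second fundamental form `II(V, W) = ∇̄_V W - ∇_V W` of an immersion `ψ : M → N` into a
manifold with nondegenerate metric `g`, where `∇̄` and `∇` are the Levi-Civita connections of `g`
and of the induced metric `ψ^* g`. It is computed at `q` with the fields on `M` that have constant
components in the chart at `q`, whose derivative `∇̄_V W` along `ψ` is
`D²ψ(v, w) + Γ̄(dψ v, dψ w)` in the charts at `q` and `ψ q`. -/
def secondFundamentalForm (I' : ModelWithCorners ℝ E' H') (g : BilinField I N) (ψ : M → N) (q : M)
    (v w : TangentSpace I' q) : TangentSpace I (ψ q) :=
  let ψ' : E' → E := writtenInExtChartAt I' I q ψ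
  (show TangentSpace I (ψ q) from
      fderiv ℝ (fun y ↦ fderiv ℝ ψ' y w) (extChartAt I' q q) v)
    + christoffel g (ψ q) (mfderiv I' I ψ q v) (mfderiv I' I ψ q w)
    - mfderiv I' I ψ q (christoffel (pullbackField I' g ψ) q v w)

end PseudoRiemannian

section Hypersurface

variable {m : ℕ} {E : Type*} [NormedAddCommGroup E] [NormedSpace ℝ E]
  {H : Type*} [TopologicalSpace H] {I : ModelWithCorners ℝ E H}
  {N : Type*} [TopologicalSpace N] [ChartedSpace H N]
  {M : Type*} [TopologicalSpace M] [ChartedSpace (EuclideanSpace ℝ (Fin m)) M]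

/-- The coordinate vectors of the chart at `q`, in the tangent space at `q`. -/
def coordVector (q : M) (i : Fin m) : TangentSpace (𝓡 m) q :=
  (EuclideanSpace.single i (1 : ℝ) : EuclideanSpace ℝ (Fin m))

/-- The Gram matrix `(g_ij)` of a bilinear form in the coordinate basis at `q`. -/
def gramMatrix (g : BilinField (𝓡 m) M) (q : M) : Matrix (Fin m) (Fin m) ℝ :=
  Matrix.of fun i j ↦ g q (coordVector q i) (coordVector q j)

/-- The mean curvature vector `(1/m) trace II = (1/m) ∑ g^{ij} II(∂_i, ∂_j)` of an immersion `ψ` of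
an `m`-dimensional manifold; the trace is with respect to the induced metric. -/
def meanCurvatureVector (g : BilinField I N) (ψ : M → N) (q : M) : TangentSpace I (ψ q) :=
  (1 / m : ℝ) • ∑ i, ∑ j, (gramMatrix (pullbackField (𝓡 m) g ψ) q)⁻¹ i j •
    secondFundamentalForm (𝓡 m) g ψ q (coordVector q i) (coordVector q j)

end Hypersurface

/-- The data of a doubly warped product spacetime `I ₕ×ᵨ P` with fiber the `m`-dimensional manifold
`P`. The interval `I` is an open subset of `ℝ`, the function `ρ` is only relevant on `I`, and the
spacetime is the open subset `I × P` of `ℝ × P`. -/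
structure DoublyWarpedProduct (m : ℕ) (P : Type u) [TopologicalSpace P]
    [ChartedSpace (EuclideanSpace ℝ (Fin m)) P] [IsManifold (𝓡 m) ∞ P] where
  /-- the open interval of times -/
  I : Set ℝ
  isOpen_I : IsOpen I
  ordConnected_I : I.OrdConnected
  nonempty_I : I.Nonempty
  /-- the Riemannian metric of the fiber -/
  σ : Bundle.ContMDiffRiemannianMetric (𝓡 m) ∞ (EuclideanSpace ℝ (Fin m))
    (fun x : P ↦ TangentSpace (𝓡 m) x)
  /-- the warping function on the fiber -/
  h : P → ℝ
  contMDiff_h : ContMDiff (𝓡 m) 𝓘(ℝ, ℝ) ∞ h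
  h_pos : ∀ x, 0 < h x
  /-- the warping function on the interval -/
  ρ : ℝ → ℝ
  contDiffOn_ρ : ContDiffOn ℝ ∞ ρ I
  ρ_pos : ∀ t ∈ I, 0 < ρ t

namespace DoublyWarpedProduct

variable {m : ℕ} {P : Type u} [TopologicalSpace P]
    [ChartedSpace (EuclideanSpace ℝ (Fin m)) P] [IsManifold (𝓡 m) ∞ P]
    (S : DoublyWarpedProduct m P)

/-- The form `dt²` on `ℝ`. -/
def dtSq : BilinField 𝓘(ℝ, ℝ) ℝ := fun _ ↦ ContinuousLinearMap.mul ℝ ℝ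

/-- The metric `-h(x)² π_I^*(dt²) + ρ(t)² π_P^*(σ)`. -/
def metric : BilinField (𝓘(ℝ, ℝ).prod (𝓡 m)) (ℝ × P) := fun p ↦
  -((S.h p.2) ^ 2 • pullbackField (𝓘(ℝ, ℝ).prod (𝓡 m)) dtSq (Prod.fst : ℝ × P → ℝ) p) +
    (S.ρ p.1) ^ 2 • pullbackField (𝓘(ℝ, ℝ).prod (𝓡 m)) S.σ.inner (Prod.snd : ℝ × P → P) p

/-- The time orientation: the coordinate vector field `∂/∂t`. -/
def timeField (p : ℝ × P) : TangentSpace (𝓘(ℝ, ℝ).prod (𝓡 m)) p :=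
  ((1, 0) : ℝ × EuclideanSpace ℝ (Fin m))

section

variable {M : Type v} [TopologicalSpace M] [ChartedSpace (EuclideanSpace ℝ (Fin m)) M]

/-- `ψ : M → I × P` is an immersed spacelike hypersurface: it is smooth and the induced metric
is Riemannian (which forces `ψ` to be an immersion). -/
structure IsSpacelikeHypersurface (ψ : M → ℝ × P) : Prop where
  mem : ∀ q, (ψ q).1 ∈ S.I
  contMDiff : ContMDiff (𝓡 m) (𝓘(ℝ, ℝ).prod (𝓡 m)) ∞ ψ
  pos : ∀ (q : M) (v : TangentSpace (𝓡 m) q), v ≠ 0 →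
    0 < pullbackField (𝓡 m) S.metric ψ q v v

/-- `n` is a future-pointing unit (timelike) normal vector of `ψ` at `q`. -/
def IsFutureUnitNormal (ψ : M → ℝ × P) (q : M)
    (n : TangentSpace (𝓘(ℝ, ℝ).prod (𝓡 m)) (ψ q)) : Prop :=
  (∀ v : TangentSpace (𝓡 m) q,
      S.metric (ψ q) n (mfderiv (𝓡 m) (𝓘(ℝ, ℝ).prod (𝓡 m)) ψ q v) = 0) ∧
    S.metric (ψ q) n n = -1 ∧ S.metric (ψ q) n (timeField (ψ q)) < 0

/-- The future-pointing unit normal of a spacelike hypersurface, which exists and is unique. -/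
def unitNormal (ψ : M → ℝ × P) (q : M) : TangentSpace (𝓘(ℝ, ℝ).prod (𝓡 m)) (ψ q) :=
  Classical.epsilon (S.IsFutureUnitNormal ψ q)

/-- The mean curvature function of a spacelike hypersurface, in the direction of the
future-pointing unit normal. -/
def meanCurvature (ψ : M → ℝ × P) (q : M) : ℝ :=
  -S.metric (ψ q) (meanCurvatureVector (m := m) S.metric ψ q) (S.unitNormal ψ q)

/-- A maximal hypersurface is a spacelike hypersurface with `H = 0`. -/
structure IsMaximal (ψ : M → ℝ × P) : Prop extends S.IsSpacelikeHypersurface ψ where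
  meanCurvature_eq_zero : ∀ q, S.meanCurvature ψ q = 0

/-- A totally geodesic spacelike hypersurface is one with vanishing second fundamental form. -/
structure IsTotallyGeodesic (ψ : M → ℝ × P) : Prop extends S.IsSpacelikeHypersurface ψ where
  secondFundamentalForm_eq_zero : ∀ (q : M) (v w : TangentSpace (𝓡 m) q),
    secondFundamentalForm (𝓡 m) S.metric ψ q v w = 0

end

/-- The slice `Σ_t = {t} × P`. -/
def slice (t : ℝ) : P → ℝ × P := fun x ↦ (t, x)

/-- The spacetime admits a (nonempty, possibly disconnected) compact maximal hypersurface. -/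
def AdmitsCompactMaximalHypersurface : Prop :=
  ∃ (M : Type u) (_ : TopologicalSpace M) (_ : ChartedSpace (EuclideanSpace ℝ (Fin m)) M)
    (ψ : M → ℝ × P), IsManifold (𝓡 m) ∞ M ∧ T2Space M ∧ CompactSpace M ∧ Nonempty M ∧
      S.IsMaximal ψ

/-- The spacetime admits a connected compact maximal hypersurface. -/
def AdmitsConnectedCompactMaximalHypersurface : Prop :=
  ∃ (M : Type u) (_ : TopologicalSpace M) (_ : ChartedSpace (EuclideanSpace ℝ (Fin m)) M)
    (ψ : M → ℝ × P), IsManifold (𝓡 m) ∞ M ∧ T2Space M ∧ CompactSpace M ∧ ConnectedSpace M ∧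
      S.IsMaximal ψ

end DoublyWarpedProduct

end

noncomputable section

open ContinuousLinearMap Topology Filter

/-! ### Nondegenerate bilinear forms as invertible maps to the dual. -/

section LinearAlgebra

variable {V : Type*} [NormedAddCommGroup V] [NormedSpace ℝ V]

/-! Let `ψ` be a compact maximal hypersurface and let `τ` be the time component of `ψ`. By
compactness `τ` has a maximum and a minimum. At a critical point of `τ` the image of `dψ` is tangent
to the fiber, so the unit normal is `h⁻¹ ∂_t`, and the time component of `II(v, w)` is `D²τ(v, w) +
(ρ' / (ρ h²)) g(v, w)`: the second term is the time component of the ambient Christoffel symbols,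
and the tangential correction has none. Tracing with the induced metric and using `H = 0` gives
`tr_g D²τ = -m ρ' / (ρ h²)` (`exists_posSemidef_sum_hessian_eq`).

The second derivative test therefore yields `ρ' ≥ 0` at the maximal time and `ρ' ≤ 0` at the minimal
time. Since `ρ'` is continuous on the interval `I`, it vanishes at some time. Connectedness is
needed of `I` only, so one argument serves both versions.

For a slice, `II = (ρ ρ' / h²) σ ⊗ ∂_t` (`secondFundamentalForm_slice`), which vanishes exactly when
`ρ' = 0`; such a slice is itself compact, connected and maximal. Both halves rest on the Christoffel
symbols of the warped metric on fiber vectors (`christoffel_metric`). -/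

/-- `christoffel` is defined through `ContinuousLinearMap.inverse`, which is zero on non-invertible
maps, so invertibility must be known before the symbols mean anything. In finite dimension
injectivity suffices, by counting dimensions. -/
theorem ContinuousLinearMap.isInvertible_of_nondegenerate [FiniteDimensional ℝ V] {B : V →L[ℝ] V →L[ℝ] ℝ}
    (hB : ∀ v, v ≠ 0 → ∃ w, B v w ≠ 0) : B.IsInvertible := by
  have hinj : Function.Injective B := by
    rw [injective_iff_map_eq_zero]
    intro v hv
    by_contra h
    obtain ⟨w, hw⟩ := hB v h
    exact hw (by simp [hv])
  have hdim : Module.finrank ℝ V = Module.finrank ℝ (V →L[ℝ] ℝ) := by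
    rw [← (LinearMap.toContinuousLinearMap (𝕜 := ℝ) (E := V) (F' := ℝ)).finrank_eq]
    exact (Subspace.dual_finrank_eq (K := ℝ) (V := V)).symm
  exact ⟨(LinearEquiv.ofInjectiveOfFinrankEq B.toLinearMap hinj hdim).toContinuousLinearEquiv,
    by ext; rfl⟩

theorem ContinuousLinearMap.IsInvertible.inverse_eq_of_apply_eq {W : Type*} [NormedAddCommGroup W]
    [NormedSpace ℝ W] {A : V →L[ℝ] W} (hA : A.IsInvertible) {x : V} {y : W}
    (h : A x = y) : A.inverse y = x := by
  subst h
  obtain ⟨e, rfl⟩ := hA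
  simp

theorem ContinuousLinearMap.IsInvertible.apply_inverse {W : Type*} [NormedAddCommGroup W]
    [NormedSpace ℝ W] {A : V →L[ℝ] W} (hA : A.IsInvertible) (y : W) : A (A.inverse y) = y := by
  obtain ⟨e, rfl⟩ := hA
  simp

end LinearAlgebra

@[simp]
theorem pullbackForm_apply {E E' : Type*} [NormedAddCommGroup E] [NormedSpace ℝ E]
    [NormedAddCommGroup E'] [NormedSpace ℝ E'] (b : E →L[ℝ] E →L[ℝ] ℝ) (L : E' →L[ℝ] E)
    (v w : E') : pullbackForm b L v w = b (L v) (L w) :=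
  ContinuousLinearMap.bilinearComp_apply _ _ _ _ _

/-! ### The metric and its Christoffel symbols in a chart. -/

section Chart

variable {E : Type*} [NormedAddCommGroup E] [NormedSpace ℝ E]
  {H : Type*} [TopologicalSpace H] {I : ModelWithCorners ℝ E H} [I.Boundaryless]
  {N : Type*} [TopologicalSpace N] [ChartedSpace H N] [IsManifold I 1 N]

theorem mfderiv_extChartAt_symm_eq_symmL {x₀ x : N} (hx : x ∈ (chartAt H x₀).source) :
    mfderiv 𝓘(ℝ, E) I (extChartAt I x₀).symm (extChartAt I x₀ x) =
      (trivializationAt E (TangentSpace I) x₀).symmL ℝ x := by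
  rw [TangentBundle.symmL_trivializationAt hx, I.range_eq_univ, mfderivWithin_univ]

/-- `TangentSpace I x₀` is identified with `E` by the preferred chart at `x₀`, so this derivative is
a coordinate change from that chart to itself. -/
theorem mfderiv_extChartAt_symm_self (x₀ : N) :
    mfderiv 𝓘(ℝ, E) I (extChartAt I x₀).symm (extChartAt I x₀ x₀) =
      ContinuousLinearMap.id ℝ E := by
  rw [mfderiv_extChartAt_symm_eq_symmL (mem_chart_source H x₀),
    TangentBundle.symmL_trivializationAt_eq_core (mem_chart_source H x₀)]
  ext v
  exact (tangentBundleCore I N).coordChange_self _ _ (mem_chart_source H x₀) v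

theorem metricInChart_self (g : BilinField I N) (x₀ : N) (v w : E) :
    metricInChart g x₀ (extChartAt I x₀ x₀) v w = g x₀ v w := by
  have h : ∀ x, x = x₀ → ∀ L : E →L[ℝ] E, L = ContinuousLinearMap.id ℝ E →
      pullbackForm (E := E) (E' := E) (g x) L v w = g x₀ v w := by
    rintro _ rfl _ rfl
    exact pullbackForm_apply _ _ _ _
  exact h _ (extChartAt_to_inv x₀) _ (mfderiv_extChartAt_symm_self x₀)

/-- The tangent trivialization at `x₀` is the derivative of the chart, so near the centre
`metricInChart` is the local expression of the section `g` of the bundle of bilinear forms, read in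
the chart. -/
theorem differentiableAt_metricInChart [FiniteDimensional ℝ E] {g : BilinField I N} {x₀ : N}
    (hg : ContMDiffAt I (I.prod 𝓘(ℝ, E →L[ℝ] E →L[ℝ] ℝ)) 1
      (fun b ↦ Bundle.TotalSpace.mk' (E →L[ℝ] E →L[ℝ] ℝ)
        (E := fun x : N ↦ TangentSpace I x →L[ℝ] TangentSpace I x →L[ℝ] ℝ) b (g b)) x₀) :
    DifferentiableAt ℝ (metricInChart g x₀) (extChartAt I x₀ x₀) := by
  have h1 := (contMDiffAt_hom_bundle _).1 hg |>.2
  have h3 : ContMDiffAt 𝓘(ℝ, E) I 1 (extChartAt I x₀).symm (extChartAt I x₀ x₀) :=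
    (contMDiffOn_extChartAt_symm x₀).contMDiffAt (extChartAt_target_mem_nhds x₀)
  have h4 := ContMDiffAt.comp (extChartAt I x₀ x₀) (by rw [extChartAt_to_inv]; exact h1) h3
  have h5 := (contMDiffAt_iff_contDiffAt.1 h4).differentiableAt one_ne_zero
  refine h5.congr_of_eventuallyEq ?_
  filter_upwards [extChartAt_target_mem_nhds (I := I) x₀] with y hy
  ext v w
  have hs : (extChartAt I x₀).symm y ∈ (chartAt H x₀).source := by
    rw [← extChartAt_source I]; exact (extChartAt I x₀).map_target hy
  have hb : (extChartAt I x₀).symm y ∈ (trivializationAt E (TangentSpace I) x₀).baseSet := by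
    simpa using hs
  have hm := mfderiv_extChartAt_symm_eq_symmL (I := I) hs
  rw [(extChartAt I x₀).right_inv hy] at hm
  simp only [Function.comp_apply]
  rw [inCoordinates_apply_eq₂ hb hb (Set.mem_univ _)]
  simp only [metricInChart, pullbackForm]
  erw [hm, Bundle.Trivial.linearMapAt_trivialization, ContinuousLinearMap.bilinearComp_apply,
    Bundle.Trivialization.symmL_apply _ hb, Bundle.Trivialization.symmL_apply _ hb]
  rfl

end Chart

section Chart

variable {E : Type*} [NormedAddCommGroup E] [NormedSpace ℝ E]
  {H : Type*} [TopologicalSpace H] {I : ModelWithCorners ℝ E H}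
  {N : Type*} [TopologicalSpace N] [ChartedSpace H N]

theorem christoffelFirst_apply {g : BilinField I N} {x₀ : N}
    (hg : DifferentiableAt ℝ (metricInChart g x₀) (extChartAt I x₀ x₀)) (v w z : E) :
    christoffelFirst g x₀ v w z = (1 / 2 : ℝ) *
      (fderiv ℝ (metricInChart g x₀) (extChartAt I x₀ x₀) v w z
        + fderiv ℝ (metricInChart g x₀) (extChartAt I x₀ x₀) w v z
        - fderiv ℝ (metricInChart g x₀) (extChartAt I x₀ x₀) z v w) := by
  have h1 : ∀ a : E, fderiv ℝ (fun y ↦ metricInChart g x₀ y a) (extChartAt I x₀ x₀) =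
      (fderiv ℝ (metricInChart g x₀) (extChartAt I x₀ x₀)).flip a := fun a ↦ by
    have := fderiv_clm_apply hg (differentiableAt_const (c := a))
    simpa using this
  have h2 : fderiv ℝ (fun y ↦ metricInChart g x₀ y v w) (extChartAt I x₀ x₀) =
      ((fderiv ℝ (metricInChart g x₀) (extChartAt I x₀ x₀)).flip v).flip w := by
    have := fderiv_clm_apply (hg.clm_apply (differentiableAt_const (c := v)))
      (differentiableAt_const (c := w))
    rw [h1] at this
    simpa using this
  change ((1 / 2 : ℝ) • (fderiv ℝ (fun y ↦ metricInChart g x₀ y w) (extChartAt I x₀ x₀) v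
    + fderiv ℝ (fun y ↦ metricInChart g x₀ y v) (extChartAt I x₀ x₀) w
    - fderiv ℝ (fun y ↦ metricInChart g x₀ y v w) (extChartAt I x₀ x₀))) z = _
  rw [h1, h1, h2]
  rfl

end Chart

section Calculus

variable {E F G : Type*} [NormedAddCommGroup E] [NormedSpace ℝ E] [NormedAddCommGroup F]
  [NormedSpace ℝ F] [NormedAddCommGroup G] [NormedSpace ℝ G]

theorem HasFDerivAt.comp_snd {f : F → G} {f' : F →L[ℝ] G} {x : E × F}
    (hf : HasFDerivAt f f' x.2) : HasFDerivAt (fun y : E × F ↦ f y.2) (f' ∘L snd ℝ E F) x :=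
  hf.comp x hasFDerivAt_snd

theorem DifferentiableAt.smul_sub_smul_const {f : E → F} {r c : E → ℝ} {x : E}
    (hr : DifferentiableAt ℝ r x) (hc : DifferentiableAt ℝ c x) (hf : DifferentiableAt ℝ f x)
    (b : F) : DifferentiableAt ℝ (fun y ↦ r y • f y - c y • b) x :=
  (hr.smul hf).sub (hc.smul_const b)

theorem DifferentiableAt.hasFDerivAt_const_smul {f : E → F} {x : E} (hf : DifferentiableAt ℝ f x)
    (c : ℝ) : HasFDerivAt (c • f) (c • fderiv ℝ f x) x :=
  hf.hasFDerivAt.const_smul c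

end Calculus

/-! ### The warped form on the model space `ℝ × V`. -/

section WarpedForm

variable {V : Type*} [NormedAddCommGroup V] [NormedSpace ℝ V]

/-- The bilinear form `r B - c dt²` on `ℝ × V`. -/
def warpedForm (c r : ℝ) (B : V →L[ℝ] V →L[ℝ] ℝ) : (ℝ × V) →L[ℝ] (ℝ × V) →L[ℝ] ℝ :=
  r • ((compL ℝ (ℝ × V) V ℝ).flip (snd ℝ ℝ V) ∘L B ∘L snd ℝ ℝ V) -
    c • ((compL ℝ (ℝ × V) ℝ ℝ).flip (fst ℝ ℝ V) ∘L ContinuousLinearMap.mul ℝ ℝ ∘L fst ℝ ℝ V)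

@[simp]
theorem warpedForm_apply (c r : ℝ) (B : V →L[ℝ] V →L[ℝ] ℝ) (x y : ℝ × V) :
    warpedForm c r B x y = r * B x.2 y.2 - c * (x.1 * y.1) := by
  simp [warpedForm]

theorem DifferentiableAt.warpedForm {X : Type*} [NormedAddCommGroup X] [NormedSpace ℝ X]
    {c r : X → ℝ} {B : X → V →L[ℝ] V →L[ℝ] ℝ} {x : X} (hc : DifferentiableAt ℝ c x)
    (hr : DifferentiableAt ℝ r x) (hB : DifferentiableAt ℝ B x) :
    DifferentiableAt ℝ (fun y ↦ warpedForm (c y) (r y) (B y)) x := by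
  unfold _root_.warpedForm
  refine DifferentiableAt.smul_sub_smul_const (F := (ℝ × V) →L[ℝ] (ℝ × V) →L[ℝ] ℝ) hr hc ?_ _
  exact (differentiableAt_const _).clm_comp (hB.clm_comp (differentiableAt_const _))

theorem fderiv_warpedForm_apply {c : V → ℝ} {r : ℝ → ℝ} {B : V → V →L[ℝ] V →L[ℝ] ℝ} {t : ℝ} {x : V}
    (hc : DifferentiableAt ℝ c x) (hr : DifferentiableAt ℝ r t) (hB : DifferentiableAt ℝ B x)
    (u w z : ℝ × V) :
    fderiv ℝ (fun y : ℝ × V ↦ warpedForm (c y.2) (r y.1) (B y.2)) (t, x) u w z =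
      u.1 * deriv r t * B x w.2 z.2 + r t * fderiv ℝ B x u.2 w.2 z.2 -
        fderiv ℝ c x u.2 * (w.1 * z.1) := by
  have hc' := HasFDerivAt.comp_snd (E := ℝ) (x := (t, x)) hc.hasFDerivAt
  have hB' := HasFDerivAt.comp_snd (G := V →L[ℝ] V →L[ℝ] ℝ) (f := B)
    (E := ℝ) (x := (t, x)) hB.hasFDerivAt
  have hr' : HasFDerivAt (fun y : ℝ × V ↦ r y.1) (fderiv ℝ r t ∘L fst ℝ ℝ V) (t, x) :=
    HasFDerivAt.comp (t, x) (g := r) (f := Prod.fst) hr.hasFDerivAt hasFDerivAt_fst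
  have h0 := (hc'.differentiableAt.warpedForm hr'.differentiableAt hB'.differentiableAt).hasFDerivAt
  have h1 := (h0.clm_apply (hasFDerivAt_const w _)).clm_apply (hasFDerivAt_const z _)
  have hBw := (hB'.clm_apply (hasFDerivAt_const w.2 _)).clm_apply (hasFDerivAt_const z.2 _)
  -- The product rule for the scalar function obtained by evaluating at `w`, `z`; uniqueness of the
  -- derivative compares it with the derivative of the form-valued map.
  have h2 := (hr'.mul hBw).sub (hc'.mul_const (w.1 * z.1))
  have h3 := h1.unique (h2.congr_of_eventuallyEq (Eventually.of_forall fun y ↦ by simp))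
  have h4 := DFunLike.congr_fun h3 u
  have h5 : fderiv ℝ r t u.1 = u.1 * deriv r t := by
    rw [fderiv_eq_smul_deriv, smul_eq_mul]
  simp [-fderiv_eq_smul_deriv] at h4
  rw [h4, h5]
  ring

/-- A vector with nonzero fiber part is detected by that part; any other nonzero vector is detected
by `∂_t`. -/
theorem warpedForm_nondegenerate {c r : ℝ} {B : V →L[ℝ] V →L[ℝ] ℝ} (hc : c ≠ 0) (hr : r ≠ 0)
    (hB : ∀ v, v ≠ 0 → 0 < B v v) (x : ℝ × V) (hx : x ≠ 0) : ∃ y, warpedForm c r B x y ≠ 0 := by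
  by_cases h : x.2 = 0
  · have h1 : x.1 ≠ 0 := fun h1 ↦ hx (Prod.ext h1 h)
    exact ⟨(1, 0), by simp [hc, h1]⟩
  · exact ⟨(0, x.2), by simp [hr, (hB _ h).ne']⟩

end WarpedForm

/-! ### Local expression and Christoffel symbols of the spacetime metric. -/

namespace DoublyWarpedProduct

variable {m : ℕ} {P : Type u} [TopologicalSpace P]
    [ChartedSpace (EuclideanSpace ℝ (Fin m)) P] [IsManifold (𝓡 m) ∞ P]
    (S : DoublyWarpedProduct m P)

/-- The metric of the fiber, as a bilinear form on the model space. -/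
def fiberForm (x : P) : EuclideanSpace ℝ (Fin m) →L[ℝ] EuclideanSpace ℝ (Fin m) →L[ℝ] ℝ :=
  S.σ.inner x

theorem fiberForm_symm (x : P) (v w : EuclideanSpace ℝ (Fin m)) :
    S.fiberForm x v w = S.fiberForm x w v :=
  S.σ.symm x v w

theorem fiberForm_pos (x : P) {v : EuclideanSpace ℝ (Fin m)} (hv : v ≠ 0) :
    0 < S.fiberForm x v v :=
  S.σ.pos x v hv

theorem metric_eq_warpedForm (p : ℝ × P) :
    S.metric p = warpedForm (V := EuclideanSpace ℝ (Fin m)) (S.h p.2 ^ 2) (S.ρ p.1 ^ 2)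
      (S.fiberForm p.2) := by
  apply ContinuousLinearMap.ext
  intro v
  apply ContinuousLinearMap.ext
  intro w
  have e1 : pullbackField (𝓘(ℝ, ℝ).prod (𝓡 m)) dtSq (Prod.fst : ℝ × P → ℝ) p v w =
      v.1 * w.1 := by
    refine (pullbackForm_apply (E := ℝ) (E' := ℝ × EuclideanSpace ℝ (Fin m)) _ _ v w).trans ?_
    rw [mfderiv_fst]
    rfl
  have e2 : pullbackField (𝓘(ℝ, ℝ).prod (𝓡 m)) S.σ.inner (Prod.snd : ℝ × P → P) p v w =
      S.fiberForm p.2 v.2 w.2 := by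
    refine (pullbackForm_apply (E := EuclideanSpace ℝ (Fin m))
      (E' := ℝ × EuclideanSpace ℝ (Fin m)) _ _ v w).trans ?_
    rw [mfderiv_snd]
    rfl
  refine Eq.trans ?_ (warpedForm_apply (V := EuclideanSpace ℝ (Fin m)) _ _ _ v w).symm
  change -(S.h p.2 ^ 2 * pullbackField (𝓘(ℝ, ℝ).prod (𝓡 m)) dtSq (Prod.fst : ℝ × P → ℝ) p v w) +
    S.ρ p.1 ^ 2 * pullbackField (𝓘(ℝ, ℝ).prod (𝓡 m)) S.σ.inner (Prod.snd : ℝ × P → P) p v w = _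
  rw [e1, e2]
  exact neg_add_eq_sub _ _

theorem metric_apply (p : ℝ × P) (v w : ℝ × EuclideanSpace ℝ (Fin m)) :
    S.metric p v w = S.ρ p.1 ^ 2 * S.fiberForm p.2 v.2 w.2 - S.h p.2 ^ 2 * (v.1 * w.1) := by
  rw [metric_eq_warpedForm]
  exact warpedForm_apply _ _ _ _ _

/-- The product chart is the identity on the time factor, so only the fiber chart contributes to the
pullback. -/
theorem metricInChart_metric {p : ℝ × P} {u : ℝ × EuclideanSpace ℝ (Fin m)}
    (hu : u.2 ∈ (extChartAt (𝓡 m) p.2).target) :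
    metricInChart S.metric p u = warpedForm (S.h ((extChartAt (𝓡 m) p.2).symm u.2) ^ 2)
      (S.ρ u.1 ^ 2) (metricInChart S.σ.inner p.2 u.2) := by
  have : IsManifold (𝓡 m) 1 P := .of_le (n := ∞) (by decide)
  have hsymm : ((extChartAt (𝓘(ℝ, ℝ).prod (𝓡 m)) p).symm : ℝ × EuclideanSpace ℝ (Fin m) → ℝ × P) =
      Prod.map id (extChartAt (𝓡 m) p.2).symm := by
    rw [extChartAt_prod]
    ext y
    · rfl
    · simp
  have hd : mfderiv 𝓘(ℝ, ℝ × EuclideanSpace ℝ (Fin m)) (𝓘(ℝ, ℝ).prod (𝓡 m))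
      (extChartAt (𝓘(ℝ, ℝ).prod (𝓡 m)) p).symm u =
      (ContinuousLinearMap.id ℝ ℝ).prodMap (mfderiv 𝓘(ℝ, EuclideanSpace ℝ (Fin m)) (𝓡 m)
        (extChartAt (𝓡 m) p.2).symm u.2) := by
    rw [hsymm, modelWithCornersSelf_prod, ← chartedSpaceSelf_prod]
    have h1 : MDifferentiableAt 𝓘(ℝ, EuclideanSpace ℝ (Fin m)) (𝓡 m)
        (extChartAt (𝓡 m) p.2).symm u.2 :=
      (mdifferentiableOn_extChartAt_symm u.2 hu).mdifferentiableAt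
        ((isOpen_extChartAt_target p.2).mem_nhds hu)
    rw [mfderiv_prodMap mdifferentiableAt_id h1, mfderiv_id]
    rfl
  apply ContinuousLinearMap.ext
  intro v
  apply ContinuousLinearMap.ext
  intro w
  rw [warpedForm_apply]
  unfold metricInChart pullbackForm
  rw [hd]
  erw [ContinuousLinearMap.bilinearComp_apply, ContinuousLinearMap.bilinearComp_apply, hsymm,
    metric_apply]
  rfl

theorem differentiableAt_metricInChart_inner (x : P) :
    DifferentiableAt ℝ (metricInChart S.σ.inner x) (extChartAt (𝓡 m) x x) := by
  have : IsManifold (𝓡 m) 1 P := .of_le (n := ∞) (by decide)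
  exact differentiableAt_metricInChart ((S.σ.contMDiff x).of_le (by decide))

variable {S} in
theorem differentiableAt_ρ {t : ℝ} (ht : t ∈ S.I) : DifferentiableAt ℝ S.ρ t :=
  (S.contDiffOn_ρ.contDiffAt (S.isOpen_I.mem_nhds ht)).differentiableAt (by decide)

theorem differentiableAt_h_extChartAt_symm (x : P) :
    DifferentiableAt ℝ (fun y ↦ S.h ((extChartAt (𝓡 m) x).symm y)) (extChartAt (𝓡 m) x x) := by
  have h3 : ContMDiffAt 𝓘(ℝ, EuclideanSpace ℝ (Fin m)) (𝓡 m) ∞ (extChartAt (𝓡 m) x).symm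
      (extChartAt (𝓡 m) x x) :=
    (contMDiffOn_extChartAt_symm x).contMDiffAt (extChartAt_target_mem_nhds x)
  exact (contMDiffAt_iff_contDiffAt.1 (S.contMDiff_h.contMDiffAt.comp _ h3)).differentiableAt
    (by decide)

theorem metricInChart_metric_eventuallyEq (p : ℝ × P) :
    metricInChart S.metric p =ᶠ[𝓝 (p.1, extChartAt (𝓡 m) p.2 p.2)] fun u ↦
      warpedForm (S.h ((extChartAt (𝓡 m) p.2).symm u.2) ^ 2)
        (S.ρ u.1 ^ 2) (metricInChart S.σ.inner p.2 u.2) := by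
  filter_upwards [continuousAt_snd (extChartAt_target_mem_nhds (I := 𝓡 m) p.2)] with u hu
  exact S.metricInChart_metric hu

omit [IsManifold (𝓡 m) ∞ P] in
theorem extChartAt_prod_self (p : ℝ × P) :
    extChartAt (𝓘(ℝ, ℝ).prod (𝓡 m)) p p = (p.1, extChartAt (𝓡 m) p.2 p.2) := by
  rw [extChartAt_prod]
  rfl

/-- The Christoffel symbols of the first kind of the doubly warped product, for vectors tangent to
the fiber. -/
theorem christoffelFirst_metric {p : ℝ × P} (hp : p.1 ∈ S.I) (v w : EuclideanSpace ℝ (Fin m))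
    (z : ℝ × EuclideanSpace ℝ (Fin m)) :
    christoffelFirst S.metric p ((0, v) : ℝ × EuclideanSpace ℝ (Fin m))
      ((0, w) : ℝ × EuclideanSpace ℝ (Fin m)) z =
      S.ρ p.1 ^ 2 * christoffelFirst S.σ.inner p.2 v w z.2 -
        z.1 * (S.ρ p.1 * deriv S.ρ p.1) * S.fiberForm p.2 v w := by
  have : IsManifold (𝓡 m) 1 P := .of_le (n := ∞) (by decide)
  have hu := extChartAt_prod_self (m := m) p
  have hev := S.metricInChart_metric_eventuallyEq p
  have hc := (S.differentiableAt_h_extChartAt_symm p.2).pow 2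
  have hr := (differentiableAt_ρ hp).pow 2
  have hB := S.differentiableAt_metricInChart_inner p.2
  have hd : DifferentiableAt ℝ (metricInChart S.metric p) (p.1, extChartAt (𝓡 m) p.2 p.2) :=
    (DifferentiableAt.warpedForm
      (DifferentiableAt.comp (p.1, extChartAt (𝓡 m) p.2 p.2) (f := Prod.snd) hc
        differentiableAt_snd)
      (DifferentiableAt.comp (p.1, extChartAt (𝓡 m) p.2 p.2) (f := Prod.fst) hr
        differentiableAt_fst)
      (HasFDerivAt.comp_snd (G := EuclideanSpace ℝ (Fin m) →L[ℝ] EuclideanSpace ℝ (Fin m) →L[ℝ] ℝ)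
        (f := metricInChart S.σ.inner p.2) (E := ℝ)
        (x := (p.1, extChartAt (𝓡 m) p.2 p.2)) hB.hasFDerivAt).differentiableAt
      ).congr_of_eventuallyEq hev
  have hF := fun u w z ↦ fderiv_warpedForm_apply hc hr hB u w z
  have hρ : deriv (S.ρ ^ 2) p.1 = 2 * S.ρ p.1 * deriv S.ρ p.1 := by
    simp [deriv_pow (differentiableAt_ρ hp)]
  rw [christoffelFirst_apply (hu ▸ hd), christoffelFirst_apply hB, hu]
  erw [hev.fderiv_eq, hF, hF, hF]
  have hs : metricInChart S.σ.inner p.2 (extChartAt (𝓡 m) p.2 p.2) v w = S.fiberForm p.2 v w :=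
    metricInChart_self (I := 𝓡 m) S.σ.inner p.2 v w
  -- Both arguments have zero time component, so every term with a derivative of `h²` drops out and
  -- `ρ²` is differentiated only in the direction `z`.
  simp only [Pi.pow_apply, zero_mul, mul_zero, zero_add, sub_zero]
  rw [hρ, hs]
  ring

end DoublyWarpedProduct

section Chart

variable {E : Type*} [NormedAddCommGroup E] [NormedSpace ℝ E]
  {H : Type*} [TopologicalSpace H] {I : ModelWithCorners ℝ E H}
  {N : Type*} [TopologicalSpace N] [ChartedSpace H N]

/-- Homothetic metrics share their Levi-Civita connection: the factor `c` multiplies both the metric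
and the symbols of the first kind. It applies to a slice, whose induced metric is `ρ(t)² σ`. -/
theorem christoffel_const_smul {g : BilinField I N} {x₀ : N} {c : ℝ} (hc : c ≠ 0)
    (hg : DifferentiableAt ℝ (metricInChart g x₀) (extChartAt I x₀ x₀))
    (hinv : (metricInChart g x₀ (extChartAt I x₀ x₀)).IsInvertible) (v w : E) :
    christoffel (fun x ↦ c • g x) x₀ v w = christoffel g x₀ v w := by
  have hm : metricInChart (fun x ↦ c • g x) x₀ = c • metricInChart g x₀ := by
    ext y a b
    refine (pullbackForm_apply (E := E) (E' := E) _ _ a b).trans ?_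
    exact congrArg (c * ·) (pullbackForm_apply (E := E) (E' := E) _ _ a b).symm
  have hd' := DifferentiableAt.hasFDerivAt_const_smul (F := E →L[ℝ] E →L[ℝ] ℝ) hg c
  rw [← hm] at hd'
  have hd := hd'.differentiableAt
  have hinv' : (metricInChart (fun x ↦ c • g x) x₀ (extChartAt I x₀ x₀)).IsInvertible := by
    obtain ⟨e, he⟩ := hinv
    refine ⟨e.trans (ContinuousLinearEquiv.smulLeft (Units.mk0 c hc)), ?_⟩
    rw [hm, Pi.smul_apply, ← he]
    rfl
  have hf : ∀ a b d, fderiv ℝ (metricInChart (fun x ↦ c • g x) x₀) (extChartAt I x₀ x₀) a b d =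
      c * fderiv ℝ (metricInChart g x₀) (extChartAt I x₀ x₀) a b d := by
    intro a b d
    rw [hd'.fderiv]
    rfl
  refine hinv'.inverse_eq_of_apply_eq ?_
  ext z
  rw [hm]
  refine (congrArg (c * ·) (DFunLike.congr_fun
    (hinv.apply_inverse (christoffelFirst g x₀ v w)) z)).trans ?_
  erw [christoffelFirst_apply hd v w z, christoffelFirst_apply hg v w z]
  rw [hf, hf, hf]
  ring

end Chart

namespace DoublyWarpedProduct

variable {m : ℕ} {P : Type u} [TopologicalSpace P]
    [ChartedSpace (EuclideanSpace ℝ (Fin m)) P] [IsManifold (𝓡 m) ∞ P]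
    (S : DoublyWarpedProduct m P)

theorem metricInChart_inner_self (x : P) (v w : EuclideanSpace ℝ (Fin m)) :
    metricInChart S.σ.inner x (extChartAt (𝓡 m) x x) v w = S.fiberForm x v w :=
  have : IsManifold (𝓡 m) 1 P := .of_le (n := ∞) (by decide)
  metricInChart_self (I := 𝓡 m) S.σ.inner x v w

theorem metricInChart_inner_pos (x : P) (v : EuclideanSpace ℝ (Fin m)) (hv : v ≠ 0) :
    0 < metricInChart S.σ.inner x (extChartAt (𝓡 m) x x) v v := by
  rw [metricInChart_inner_self]
  exact S.fiberForm_pos x hv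

theorem isInvertible_metricInChart_inner (x : P) :
    (metricInChart S.σ.inner x (extChartAt (𝓡 m) x x)).IsInvertible :=
  isInvertible_of_nondegenerate fun v hv ↦ ⟨v, (S.metricInChart_inner_pos x v hv).ne'⟩

/-- The Christoffel symbols of the doubly warped product, for vectors tangent to the fiber. -/
theorem christoffel_metric {p : ℝ × P} (hp : p.1 ∈ S.I) (v w : EuclideanSpace ℝ (Fin m)) :
    christoffel S.metric p ((0, v) : ℝ × EuclideanSpace ℝ (Fin m))
      ((0, w) : ℝ × EuclideanSpace ℝ (Fin m)) =
      ((S.ρ p.1 * deriv S.ρ p.1 / S.h p.2 ^ 2 * S.fiberForm p.2 v w,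
        christoffel S.σ.inner p.2 v w) : ℝ × EuclideanSpace ℝ (Fin m)) := by
  have hh := (S.h_pos p.2).ne'
  have hρ := (S.ρ_pos p.1 hp).ne'
  have hm : metricInChart S.metric p (extChartAt (𝓘(ℝ, ℝ).prod (𝓡 m)) p p) =
      warpedForm (S.h p.2 ^ 2) (S.ρ p.1 ^ 2)
        (metricInChart S.σ.inner p.2 (extChartAt (𝓡 m) p.2 p.2)) := by
    rw [extChartAt_prod_self, S.metricInChart_metric (mem_extChartAt_target p.2),
      extChartAt_to_inv]
  have hinv : (metricInChart S.metric p (extChartAt (𝓘(ℝ, ℝ).prod (𝓡 m)) p p)).IsInvertible := by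
    rw [hm]
    exact isInvertible_of_nondegenerate (warpedForm_nondegenerate (pow_ne_zero 2 hh)
      (pow_ne_zero 2 hρ) (S.metricInChart_inner_pos p.2))
  -- It suffices that the proposed vector satisfies the equation defining the symbols of the second
  -- kind.
  refine hinv.inverse_eq_of_apply_eq ?_
  refine ContinuousLinearMap.ext fun z ↦ ?_
  rw [hm, S.christoffelFirst_metric hp, warpedForm_apply]
  have h1 : metricInChart S.σ.inner p.2 (extChartAt (𝓡 m) p.2 p.2)
      (christoffel S.σ.inner p.2 v w) = christoffelFirst S.σ.inner p.2 v w :=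
    (S.isInvertible_metricInChart_inner p.2).apply_inverse _
  rw [h1]
  field_simp

/-! ### Geometry of the slices. -/

omit [IsManifold (𝓡 m) ∞ P] in
theorem mfderiv_slice (t : ℝ) (x : P) :
    mfderiv (𝓡 m) (𝓘(ℝ, ℝ).prod (𝓡 m)) (slice t) x =
      ContinuousLinearMap.inr ℝ ℝ (EuclideanSpace ℝ (Fin m)) :=
  mfderiv_prod_right

theorem pullbackField_slice (t : ℝ) :
    pullbackField (𝓡 m) S.metric (slice t) = fun x ↦ S.ρ t ^ 2 • S.σ.inner x := by
  funext x
  apply ContinuousLinearMap.ext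
  intro v
  apply ContinuousLinearMap.ext
  intro w
  refine (pullbackForm_apply (E := ℝ × EuclideanSpace ℝ (Fin m)) (E' := EuclideanSpace ℝ (Fin m))
    _ _ v w).trans ?_
  rw [mfderiv_slice]
  refine (S.metric_apply _ _ _).trans ?_
  change S.ρ t ^ 2 * S.fiberForm x v w - S.h x ^ 2 * (0 * 0) = S.ρ t ^ 2 * S.fiberForm x v w
  rw [mul_zero, mul_zero, sub_zero]

/-- In charts the slice is the affine map `y ↦ (t, y)`, so the flat second derivative vanishes. The
fiber components of the ambient and induced Christoffel symbols are both those of `σ` and cancel,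
leaving the ambient time component. -/
theorem secondFundamentalForm_slice {t : ℝ} (ht : t ∈ S.I) (x : P)
    (v w : EuclideanSpace ℝ (Fin m)) :
    secondFundamentalForm (𝓡 m) S.metric (slice t) x v w =
      ((S.ρ t * deriv S.ρ t / S.h x ^ 2 * S.fiberForm x v w, 0) :
        ℝ × EuclideanSpace ℝ (Fin m)) := by
  have hψ : writtenInExtChartAt (𝓡 m) (𝓘(ℝ, ℝ).prod (𝓡 m)) x (slice t) =ᶠ[
      𝓝 (extChartAt (𝓡 m) x x)] fun y ↦ (t, y) := by
    filter_upwards [extChartAt_target_mem_nhds (I := 𝓡 m) x] with y hy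
    rw [writtenInExtChartAt, extChartAt_prod]
    exact Prod.ext rfl ((extChartAt (𝓡 m) x).right_inv hy)
  have h2 : fderiv ℝ (fun y ↦ fderiv ℝ (writtenInExtChartAt (𝓡 m) (𝓘(ℝ, ℝ).prod (𝓡 m)) x
      (slice t)) y w) (extChartAt (𝓡 m) x x) = 0 := by
    have h3 : (fun y ↦ fderiv ℝ (writtenInExtChartAt (𝓡 m) (𝓘(ℝ, ℝ).prod (𝓡 m)) x
        (slice t)) y w) =ᶠ[𝓝 (extChartAt (𝓡 m) x x)] fun y ↦ (0, w) := by
      filter_upwards [hψ.fderiv (𝕜 := ℝ)] with y hy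
      rw [hy, (hasFDerivAt_prodMk_right (𝕜 := ℝ) t y).fderiv]
      rfl
    rw [h3.fderiv_eq]
    exact hasFDerivAt_const (𝕜 := ℝ) ((0, w) : ℝ × EuclideanSpace ℝ (Fin m)) _ |>.fderiv
  have hc : christoffel S.metric (slice t x) (mfderiv (𝓡 m) (𝓘(ℝ, ℝ).prod (𝓡 m)) (slice t) x v)
      (mfderiv (𝓡 m) (𝓘(ℝ, ℝ).prod (𝓡 m)) (slice t) x w) =
      ((S.ρ t * deriv S.ρ t / S.h x ^ 2 * S.fiberForm x v w, christoffel S.σ.inner x v w) :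
        ℝ × EuclideanSpace ℝ (Fin m)) := by
    rw [mfderiv_slice]
    exact S.christoffel_metric (p := (t, x)) ht v w
  have hc' : mfderiv (𝓡 m) (𝓘(ℝ, ℝ).prod (𝓡 m)) (slice t) x
      (christoffel (pullbackField (𝓡 m) S.metric (slice t)) x v w) =
      ((0, christoffel S.σ.inner x v w) : ℝ × EuclideanSpace ℝ (Fin m)) := by
    rw [pullbackField_slice, christoffel_const_smul (pow_ne_zero 2 (S.ρ_pos t ht).ne')
      (S.differentiableAt_metricInChart_inner x) (S.isInvertible_metricInChart_inner x) v w,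
      mfderiv_slice]
    rfl
  have key : ∀ (r : ℝ) (z : EuclideanSpace ℝ (Fin m)) (a b c : ℝ × EuclideanSpace ℝ (Fin m)),
      a = 0 → b = (r, z) → c = (0, z) → a + b - c = (r, 0) := by
    rintro r z _ _ _ rfl rfl rfl
    simp
  exact key _ _ _ _ _ (DFunLike.congr_fun h2 v) hc hc'

theorem isSpacelikeHypersurface_slice {t : ℝ} (ht : t ∈ S.I) :
    S.IsSpacelikeHypersurface (slice t : P → ℝ × P) where
  mem _ := ht
  contMDiff := contMDiff_const.prodMk contMDiff_id
  pos x v hv := by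
    rw [pullbackField_slice]
    exact mul_pos (pow_pos (S.ρ_pos t ht) 2) (S.σ.pos x v hv)

theorem isTotallyGeodesic_slice_iff [Nonempty P] (hm : 1 ≤ m) {t : ℝ} (ht : t ∈ S.I) :
    S.IsTotallyGeodesic (slice t : P → ℝ × P) ↔ deriv S.ρ t = 0 := by
  constructor
  · intro h
    obtain ⟨x⟩ := ‹Nonempty P›
    -- Since `m ≥ 1` there is a nonzero tangent vector, on which `σ` is positive.
    let e : EuclideanSpace ℝ (Fin m) := EuclideanSpace.single ⟨0, hm⟩ 1
    have he : e ≠ 0 := by simp [e]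
    have h1 := h.secondFundamentalForm_eq_zero x e e
    rw [S.secondFundamentalForm_slice ht] at h1
    have h2 : S.ρ t * deriv S.ρ t / S.h x ^ 2 * S.fiberForm x e e = 0 := congrArg Prod.fst h1
    simpa [(S.ρ_pos t ht).ne', (S.h_pos x).ne', (S.fiberForm_pos x he).ne'] using h2
  · intro h
    refine ⟨S.isSpacelikeHypersurface_slice ht, fun x v w ↦ ?_⟩
    refine (S.secondFundamentalForm_slice ht x v w).trans ?_
    rw [h, mul_zero, zero_div, zero_mul]
    rfl

theorem IsTotallyGeodesic.isMaximal {M : Type v} [TopologicalSpace M]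
    [ChartedSpace (EuclideanSpace ℝ (Fin m)) M] {ψ : M → ℝ × P}
    (h : S.IsTotallyGeodesic ψ) : S.IsMaximal ψ where
  toIsSpacelikeHypersurface := h.toIsSpacelikeHypersurface
  meanCurvature_eq_zero q := by
    have : meanCurvatureVector (m := m) S.metric ψ q = 0 := by
      simp [meanCurvatureVector, h.secondFundamentalForm_eq_zero]
    simp [meanCurvature, this]

end DoublyWarpedProduct

/-! ### Second derivative tests. -/

section Calculus

variable {V : Type*} [NormedAddCommGroup V] [NormedSpace ℝ V]

/-- A positive second derivative would make `x` a local minimum as well; then `g` is locally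
constant and its second derivative is zero. -/
theorem IsLocalMax.deriv_deriv_nonpos {g : ℝ → ℝ} {x : ℝ} (hg : IsLocalMax g x)
    (hc : ContinuousAt g x) : deriv (deriv g) x ≤ 0 := by
  by_contra! h
  have hmin := isLocalMin_of_deriv_deriv_pos h hg.deriv_eq_zero hc
  have heq : g =ᶠ[𝓝 x] fun _ ↦ g x := by
    filter_upwards [hg, hmin] with y h1 h2 using le_antisymm h1 h2
  have h2 := heq.deriv.deriv_eq
  simp only [deriv_const', deriv_const] at h2
  exact h.ne' h2

/-- Restriction to the line `s ↦ x + s • v` reduces this to one variable. -/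
theorem IsLocalMax.fderiv_fderiv_apply_self_nonpos {f : V → ℝ} {x : V} (hf : IsLocalMax f x)
    (hd : ContDiffAt ℝ 2 f x) (v : V) : fderiv ℝ (fderiv ℝ f) x v v ≤ 0 := by
  have hline : ∀ s : ℝ, HasDerivAt (fun s : ℝ ↦ x + s • v) v s := fun s ↦ by
    simpa using ((hasDerivAt_id s).smul_const v).const_add x
  have hx : x + (0 : ℝ) • v = x := by simp
  have hcont : Tendsto (fun s : ℝ ↦ x + s • v) (𝓝 0) (𝓝 x) := by
    simpa only [ContinuousAt, hx] using (hline 0).continuousAt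
  have hmax : IsLocalMax (fun s : ℝ ↦ f (x + s • v)) 0 := by
    filter_upwards [hcont.eventually hf] with s hs
    simpa using hs
  have hdiff : ∀ᶠ y in 𝓝 x, DifferentiableAt ℝ f y :=
    (hd.eventually (by simp)).mono fun y hy ↦ hy.differentiableAt (by simp)
  have h1 : deriv (fun s : ℝ ↦ f (x + s • v)) =ᶠ[𝓝 0] fun s ↦ fderiv ℝ f (x + s • v) v := by
    filter_upwards [hcont.eventually hdiff] with s hs
    exact (hs.hasFDerivAt.comp_hasDerivAt s (hline s)).deriv
  have hd2 : DifferentiableAt ℝ (fderiv ℝ f) x :=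
    (hd.fderiv_right (m := 1) (by norm_num)).differentiableAt (by simp)
  have hv : HasFDerivAt (fun y ↦ fderiv ℝ f y v) ((fderiv ℝ (fderiv ℝ f) x).flip v) x := by
    simpa using hd2.hasFDerivAt.clm_apply (hasFDerivAt_const v x)
  have h2 := HasFDerivAt.comp_hasDerivAt_of_eq 0 hv (hline 0) hx.symm
  have h3 := hmax.deriv_deriv_nonpos
    (ContinuousAt.comp (g := f) (by rw [hx]; exact hd.continuousAt) (hline 0).continuousAt)
  rw [h1.deriv_eq] at h3
  exact h2.deriv.symm.trans_le h3

theorem IsLocalMin.fderiv_fderiv_apply_self_nonneg {f : V → ℝ} {x : V} (hf : IsLocalMin f x)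
    (hd : ContDiffAt ℝ 2 f x) (v : V) : 0 ≤ fderiv ℝ (fderiv ℝ f) x v v := by
  have h := hf.neg.fderiv_fderiv_apply_self_nonpos hd.neg v
  have h1 : fderiv ℝ (fun y ↦ -f y) = fun y ↦ -fderiv ℝ f y := funext fun y ↦ fderiv_fun_neg
  rw [h1, fderiv_fun_neg] at h
  exact neg_nonpos.1 h

theorem fst_fderiv_fderiv_apply {W : Type*} [NormedAddCommGroup W] [NormedSpace ℝ W]
    {f : V → ℝ × W} {x : V} (hf : ContDiffAt ℝ 2 f x) (v w : V) :
    (fderiv ℝ (fun y ↦ fderiv ℝ f y w) x v).1 =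
      fderiv ℝ (fderiv ℝ (fun y ↦ (f y).1)) x v w := by
  have hdiff : ∀ᶠ y in 𝓝 x, DifferentiableAt ℝ f y :=
    (hf.eventually (by simp)).mono fun y hy ↦ hy.differentiableAt (by simp)
  have h1 : fderiv ℝ (fun y ↦ (f y).1) =ᶠ[𝓝 x] fun y ↦ fst ℝ ℝ W ∘L fderiv ℝ f y := by
    filter_upwards [hdiff] with y hy
    exact hy.hasFDerivAt.fst.fderiv
  have hd2 : DifferentiableAt ℝ (fderiv ℝ f) x :=
    (hf.fderiv_right (m := 1) (by norm_num)).differentiableAt (by simp)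
  have h2 := hd2.hasFDerivAt.clm_apply (hasFDerivAt_const w x)
  have h3 := (hasFDerivAt_const (fst ℝ ℝ W) x).clm_comp hd2.hasFDerivAt
  rw [h1.fderiv_eq, h3.fderiv, h2.fderiv]
  simp

end Calculus

/-! ### Traces of bilinear forms and Gram matrices. -/

/-- Writing `K` as a sum of rank-one matrices `u_k u_kᵀ` turns the contraction into a sum of
diagonal values of `D`, at the vectors `∑ i, u_k i • e i`. -/
theorem Matrix.PosSemidef.sum_mul_apply_nonpos {ι V : Type*} [Fintype ι] [AddCommGroup V]
    [Module ℝ V] {K : Matrix ι ι ℝ} (hK : K.PosSemidef) (D : V →ₗ[ℝ] V →ₗ[ℝ] ℝ)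
    (hD : ∀ v, D v v ≤ 0) (e : ι → V) : ∑ i, ∑ j, K i j * D (e i) (e j) ≤ 0 := by
  obtain ⟨n, u, rfl⟩ := Matrix.posSemidef_iff_eq_sum_vecMulVec.1 hK
  have h : ∑ i, ∑ j, (∑ k, Matrix.vecMulVec (u k) (star (u k))) i j * D (e i) (e j) =
      ∑ k, D (∑ i, u k i • e i) (∑ j, u k j • e j) := by
    simp only [Matrix.sum_apply, Matrix.vecMulVec_apply, star_trivial, map_sum,
      map_smul, LinearMap.sum_apply, LinearMap.smul_apply, smul_eq_mul, Finset.sum_mul,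
      Finset.mul_sum]
    rw [Finset.sum_congr rfl fun i _ ↦ Finset.sum_comm, Finset.sum_comm]
    refine Finset.sum_congr rfl fun k _ ↦ ?_
    rw [Finset.sum_comm]
    exact Finset.sum_congr rfl fun i _ ↦ Finset.sum_congr rfl fun j _ ↦ by ring
  rw [h]
  exact Finset.sum_nonpos fun k _ ↦ hD _

theorem Matrix.PosSemidef.sum_mul_apply_nonneg {ι V : Type*} [Fintype ι] [AddCommGroup V]
    [Module ℝ V] {K : Matrix ι ι ℝ} (hK : K.PosSemidef) (D : V →ₗ[ℝ] V →ₗ[ℝ] ℝ)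
    (hD : ∀ v, 0 ≤ D v v) (e : ι → V) : 0 ≤ ∑ i, ∑ j, K i j * D (e i) (e j) := by
  simpa using hK.sum_mul_apply_nonpos (-D) (by simpa using hD) e

theorem Matrix.posDef_of_bilin {ι V : Type*} [Fintype ι] [AddCommGroup V] [Module ℝ V]
    (D : V →ₗ[ℝ] V →ₗ[ℝ] ℝ) (hsymm : ∀ v w, D v w = D w v) (hpos : ∀ v, v ≠ 0 → 0 < D v v)
    {e : ι → V} (he : LinearIndependent ℝ e) :
    (Matrix.of fun i j ↦ D (e i) (e j)).PosDef := by
  refine .of_dotProduct_mulVec_pos (Matrix.IsHermitian.ext fun i j ↦ hsymm _ _) fun x hx ↦ ?_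
  have h : star x ⬝ᵥ (Matrix.of fun i j ↦ D (e i) (e j)).mulVec x =
      D (∑ i, x i • e i) (∑ i, x i • e i) := by
    simp only [dotProduct, Matrix.mulVec, star_trivial, Matrix.of_apply, map_sum, map_smul,
      LinearMap.sum_apply, LinearMap.smul_apply, smul_eq_mul, Finset.mul_sum]
    rw [Finset.sum_comm]
    exact Finset.sum_congr rfl fun i _ ↦ Finset.sum_congr rfl fun j _ ↦ by ring
  rw [h]
  refine hpos _ fun h0 ↦ hx ?_
  funext i
  exact Fintype.linearIndependent_iff.1 he x h0 i

/-- By symmetry of `G` the sum is the trace of `G⁻¹ * G`. This is the identity `g^{ij} g_{ij} = m`.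
-/
theorem Matrix.sum_inv_mul_self {ι : Type*} [Fintype ι] [DecidableEq ι] {G : Matrix ι ι ℝ}
    (hG : G.PosDef) : ∑ i, ∑ j, G⁻¹ i j * G i j = Fintype.card ι := by
  have h : (G⁻¹ * G).trace = Fintype.card ι := by
    rw [Matrix.nonsing_inv_mul _ ((Matrix.isUnit_iff_isUnit_det G).1 hG.isUnit), Matrix.trace_one]
  rw [← h, Matrix.trace]
  refine Finset.sum_congr rfl fun i _ ↦ Finset.sum_congr rfl fun j _ ↦ ?_
  exact congrArg _ (hG.isHermitian.apply i j).symm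

theorem linearIndependent_euclideanSpace_single (m : ℕ) :
    LinearIndependent ℝ fun i : Fin m ↦ EuclideanSpace.single i (1 : ℝ) := by
  have h := (EuclideanSpace.basisFun (Fin m) ℝ).toBasis.linearIndependent
  rw [OrthonormalBasis.coe_toBasis] at h
  rwa [show ⇑(EuclideanSpace.basisFun (Fin m) ℝ) = fun i ↦ EuclideanSpace.single i (1 : ℝ) from
    funext fun i ↦ by simp] at h

/-! ### Maximal hypersurfaces at critical points of the time function. -/

namespace DoublyWarpedProduct

variable {m : ℕ} {P : Type u} [TopologicalSpace P]
    [ChartedSpace (EuclideanSpace ℝ (Fin m)) P] [IsManifold (𝓡 m) ∞ P]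
    {S : DoublyWarpedProduct m P}
    {M : Type v} [TopologicalSpace M] [ChartedSpace (EuclideanSpace ℝ (Fin m)) M]
    {ψ : M → ℝ × P}

theorem contDiffAt_writtenInExtChartAt (hψ : S.IsSpacelikeHypersurface ψ) (q : M) :
    ContDiffAt ℝ ∞ (writtenInExtChartAt (𝓡 m) (𝓘(ℝ, ℝ).prod (𝓡 m)) q ψ)
      (extChartAt (𝓡 m) q q) := by
  have h := (contMDiffAt_iff.1 (hψ.contMDiff q)).2
  rw [ModelWithCorners.range_eq_univ, contDiffWithinAt_univ] at h
  exact h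

omit [IsManifold (𝓡 m) ∞ P] in
theorem fst_writtenInExtChartAt (q : M) :
    (fun y ↦ (writtenInExtChartAt (𝓡 m) (𝓘(ℝ, ℝ).prod (𝓡 m)) q ψ y).1) =
      fun y ↦ (ψ ((extChartAt (𝓡 m) q).symm y)).1 := by
  funext y
  rw [writtenInExtChartAt, extChartAt_prod]
  rfl

theorem fst_mfderiv_apply (hψ : S.IsSpacelikeHypersurface ψ) (q : M)
    (v : EuclideanSpace ℝ (Fin m)) :
    Prod.fst (α := ℝ) (β := EuclideanSpace ℝ (Fin m))
      (mfderiv (𝓡 m) (𝓘(ℝ, ℝ).prod (𝓡 m)) ψ q v) =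
      fderiv ℝ (fun y ↦ (ψ ((extChartAt (𝓡 m) q).symm y)).1) (extChartAt (𝓡 m) q q) v := by
  have hd := ((contDiffAt_writtenInExtChartAt hψ q).differentiableAt (by simp)).hasFDerivAt
  rw [((hψ.contMDiff q).mdifferentiableAt (by simp)).mfderiv, ModelWithCorners.range_eq_univ,
    fderivWithin_univ, ← fst_writtenInExtChartAt, hd.fst.fderiv]
  rfl

/-- At a critical point of the time function of `ψ`, the mean curvature vector is normal to the
fiber, so it vanishes if the mean curvature does. -/
theorem fst_meanCurvatureVector_eq_zero (hψ : S.IsMaximal ψ) (q : M)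
    (hcrit : ∀ v, Prod.fst (α := ℝ) (β := EuclideanSpace ℝ (Fin m))
      (mfderiv (𝓡 m) (𝓘(ℝ, ℝ).prod (𝓡 m)) ψ q v) = 0) :
    Prod.fst (α := ℝ) (β := EuclideanSpace ℝ (Fin m))
      (meanCurvatureVector (m := m) S.metric ψ q) = 0 := by
  have hh := S.h_pos (ψ q).2
  have hρ := S.ρ_pos _ (hψ.mem q)
  set L : EuclideanSpace ℝ (Fin m) →L[ℝ] ℝ × EuclideanSpace ℝ (Fin m) :=
    mfderiv (𝓡 m) (𝓘(ℝ, ℝ).prod (𝓡 m)) ψ q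
  replace hcrit : ∀ v, (L v).1 = 0 := hcrit
  have hpos : ∀ v : EuclideanSpace ℝ (Fin m), v ≠ 0 → 0 < S.metric (ψ q) (L v) (L v) := by
    intro v hv
    exact (hψ.pos q v hv).trans_eq (pullbackForm_apply (E := ℝ × EuclideanSpace ℝ (Fin m))
      (E' := EuclideanSpace ℝ (Fin m)) _ _ v v)
  -- The induced metric is definite, so `dψ` is injective; having no time component, it maps
  -- isomorphically onto the fiber directions by dimension.
  have hinj : Function.Injective (snd ℝ ℝ (EuclideanSpace ℝ (Fin m)) ∘L L) := by
    rw [injective_iff_map_eq_zero]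
    intro v hv
    by_contra h
    have h1 := hpos v h
    have h2 : L v = 0 := Prod.ext (hcrit v) hv
    rw [S.metric_apply, h2] at h1
    simp at h1
  have hsurj : Function.Surjective (snd ℝ ℝ (EuclideanSpace ℝ (Fin m)) ∘L L) :=
    LinearMap.injective_iff_surjective (f := (snd ℝ ℝ (EuclideanSpace ℝ (Fin m)) ∘L L).toLinearMap)
      |>.1 hinj
  -- The witness `h⁻¹ ∂_t` shows that a future unit normal exists, so the vector chosen by
  -- `Classical.epsilon` really is one.
  have hex : S.IsFutureUnitNormal ψ q (((S.h (ψ q).2)⁻¹, 0) : ℝ × EuclideanSpace ℝ (Fin m)) := by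
    refine ⟨fun v ↦ ?_, ?_, ?_⟩
    · refine (S.metric_apply _ _ (L v)).trans ?_
      simp [show (L v).1 = 0 from hcrit v]
    · refine (S.metric_apply _ _ _).trans ?_
      have := hh.ne'
      simp
      field_simp
    · refine (S.metric_apply _ _ (1, 0)).trans_lt ?_
      simpa using mul_pos (pow_pos hh 2) (inv_pos.2 hh)
  obtain ⟨h1, -, h3⟩ : S.IsFutureUnitNormal ψ q (S.unitNormal ψ q) :=
    Classical.epsilon_spec (p := S.IsFutureUnitNormal ψ q) ⟨_, hex⟩
  have h4 := hψ.meanCurvature_eq_zero q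
  unfold meanCurvature at h4
  generalize S.unitNormal ψ q = n at h1 h3 h4
  generalize meanCurvatureVector (m := m) S.metric ψ q = X at h4 ⊢
  change ℝ × EuclideanSpace ℝ (Fin m) at n X
  -- Some `dψ v` has the same fiber part as `n`, so orthogonality forces `σ(n.2, n.2) = 0`.
  have hn2 : n.2 = 0 := by
    obtain ⟨v, hv⟩ := hsurj n.2
    by_contra h
    have h5 := (S.metric_apply (ψ q) n (L v)).symm.trans (h1 v)
    rw [hcrit, mul_zero, mul_zero, sub_zero, show (L v).2 = n.2 from hv] at h5
    exact (mul_pos (pow_pos hρ 2) (S.fiberForm_pos _ h)).ne' h5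
  have hn1 : n.1 ≠ 0 := by
    intro h
    have h5 := (S.metric_apply (ψ q) n (1, 0)).symm.trans_lt h3
    simp [h] at h5
  have h6 := (S.metric_apply (ψ q) X n).symm.trans (neg_eq_zero.1 h4)
  -- With `n.2 = 0`, the condition `H = 0` reads `h² X.1 n.1 = 0`, and `n.1 ≠ 0`.
  simpa [hn1, hn2, hh.ne'] using h6

/-- The matrix `K` is the inverse Gram matrix of the induced metric, and the identity is the time
component of `H = 0`. Keeping only positive semidefiniteness of `K` is enough for the second
derivative tests. -/
theorem exists_posSemidef_sum_hessian_eq (hψ : S.IsMaximal ψ) (hm : 1 ≤ m) {q : M}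
    (hcrit : fderiv ℝ (fun y ↦ (ψ ((extChartAt (𝓡 m) q).symm y)).1) (extChartAt (𝓡 m) q q) = 0) :
    ∃ K : Matrix (Fin m) (Fin m) ℝ, K.PosSemidef ∧
      ∑ i, ∑ j, K i j * fderiv ℝ (fderiv ℝ (fun y ↦ (ψ ((extChartAt (𝓡 m) q).symm y)).1))
        (extChartAt (𝓡 m) q q) (EuclideanSpace.single i 1) (EuclideanSpace.single j 1) =
      -(m * (deriv S.ρ (ψ q).1 / (S.ρ (ψ q).1 * S.h (ψ q).2 ^ 2))) := by
  have hh := (S.h_pos (ψ q).2).ne'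
  have hρ := (S.ρ_pos _ (hψ.mem q)).ne'
  have hcrit' : ∀ v, Prod.fst (α := ℝ) (β := EuclideanSpace ℝ (Fin m))
      (mfderiv (𝓡 m) (𝓘(ℝ, ℝ).prod (𝓡 m)) ψ q v) = 0 := fun v ↦
    (fst_mfderiv_apply hψ.toIsSpacelikeHypersurface q v).trans (DFunLike.congr_fun hcrit v)
  have hH := fst_meanCurvatureVector_eq_zero hψ q hcrit'
  set L : EuclideanSpace ℝ (Fin m) →L[ℝ] ℝ × EuclideanSpace ℝ (Fin m) :=
    mfderiv (𝓡 m) (𝓘(ℝ, ℝ).prod (𝓡 m)) ψ q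
  have hL0 : ∀ v, L v = (0, (L v).2) := fun v ↦ Prod.ext (hcrit' v) rfl
  have hg : ∀ v w : EuclideanSpace ℝ (Fin m), pullbackField (𝓡 m) S.metric ψ q v w =
      S.ρ (ψ q).1 ^ 2 * S.fiberForm (ψ q).2 (L v).2 (L w).2 := by
    intro v w
    refine (pullbackForm_apply (E := ℝ × EuclideanSpace ℝ (Fin m)) (E' := EuclideanSpace ℝ (Fin m))
      _ _ v w).trans ?_
    refine (S.metric_apply _ (L v) (L w)).trans ?_
    rw [hL0 v]
    simp
  -- The tangential correction is an image under `dψ`, hence has no time component here. The ambient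
  -- symbols contribute `ρ ρ' / h² · σ`, which is `ρ' / (ρ h²)` times the induced metric `ρ² σ`.
  have hII : ∀ v w : EuclideanSpace ℝ (Fin m), Prod.fst (α := ℝ) (β := EuclideanSpace ℝ (Fin m))
      (secondFundamentalForm (𝓡 m) S.metric ψ q v w) =
      fderiv ℝ (fderiv ℝ (fun y ↦ (ψ ((extChartAt (𝓡 m) q).symm y)).1))
        (extChartAt (𝓡 m) q q) v w + deriv S.ρ (ψ q).1 / (S.ρ (ψ q).1 * S.h (ψ q).2 ^ 2) *
          pullbackField (𝓡 m) S.metric ψ q v w := by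
    intro v w
    have h1 := fst_fderiv_fderiv_apply ((contDiffAt_writtenInExtChartAt
      hψ.toIsSpacelikeHypersurface q).of_le (m := 2) (by decide)) v w
    rw [fst_writtenInExtChartAt] at h1
    have h2 := S.christoffel_metric (hψ.mem q) (L v).2 (L w).2
    rw [← hL0, ← hL0] at h2
    have h3 := hcrit' (christoffel (pullbackField (𝓡 m) S.metric ψ) q v w)
    have key : ∀ (r s : ℝ) (a b c : ℝ × EuclideanSpace ℝ (Fin m)),
        a.1 = r → b.1 = s → c.1 = 0 → (a + b - c).1 = r + s := by
      rintro r s a b c rfl rfl h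
      simp [h]
    refine (key _ _ _ _ _ h1 (congrArg Prod.fst h2) h3).trans ?_
    rw [hg]
    field_simp
  have hG : (gramMatrix (pullbackField (𝓡 m) S.metric ψ) q).PosDef := by
    refine Matrix.posDef_of_bilin (V := EuclideanSpace ℝ (Fin m))
      (ContinuousLinearMap.toLinearMap₁₂ (pullbackField (𝓡 m) S.metric ψ q)) (fun v w ↦ ?_)
      (fun v hv ↦ hψ.pos q v hv) (linearIndependent_euclideanSpace_single m)
    refine (hg v w).trans (Eq.trans ?_ (hg w v).symm)
    rw [S.fiberForm_symm]
  refine ⟨_, hG.inv.posSemidef, ?_⟩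
  have h5 := Matrix.sum_inv_mul_self hG
  rw [Fintype.card_fin] at h5
  have h6 : Prod.fst (α := ℝ) (β := EuclideanSpace ℝ (Fin m))
      (meanCurvatureVector (m := m) S.metric ψ q) = (1 / m : ℝ) * ∑ i, ∑ j,
        (gramMatrix (pullbackField (𝓡 m) S.metric ψ) q)⁻¹ i j *
          Prod.fst (α := ℝ) (β := EuclideanSpace ℝ (Fin m))
            (secondFundamentalForm (𝓡 m) S.metric ψ q (coordVector q i) (coordVector q j)) := by
    have key : ∀ (c : ℝ) (a : Fin m → Fin m → ℝ) (X : Fin m → Fin m → ℝ × EuclideanSpace ℝ (Fin m)),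
        (c • ∑ i, ∑ j, a i j • X i j).1 = c * ∑ i, ∑ j, a i j * (X i j).1 := by
      intro c a X
      simp [Prod.fst_sum]
    exact key _ _ _
  rw [hH] at h6
  have hm0 : (m : ℝ) ≠ 0 := by positivity
  have h7 := (mul_eq_zero.1 h6.symm).resolve_left (by positivity)
  have h8 : ∑ i, ∑ j, (gramMatrix (pullbackField (𝓡 m) S.metric ψ) q)⁻¹ i j *
          Prod.fst (α := ℝ) (β := EuclideanSpace ℝ (Fin m))
            (secondFundamentalForm (𝓡 m) S.metric ψ q (coordVector q i) (coordVector q j)) =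
      (∑ i, ∑ j, (gramMatrix (pullbackField (𝓡 m) S.metric ψ) q)⁻¹ i j *
        fderiv ℝ (fderiv ℝ (fun y ↦ (ψ ((extChartAt (𝓡 m) q).symm y)).1))
        (extChartAt (𝓡 m) q q) (EuclideanSpace.single i 1) (EuclideanSpace.single j 1)) +
      deriv S.ρ (ψ q).1 / (S.ρ (ψ q).1 * S.h (ψ q).2 ^ 2) *
        ∑ i, ∑ j, (gramMatrix (pullbackField (𝓡 m) S.metric ψ) q)⁻¹ i j *
          gramMatrix (pullbackField (𝓡 m) S.metric ψ) q i j := by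
    rw [Finset.mul_sum, ← Finset.sum_add_distrib]
    refine Finset.sum_congr rfl fun i _ ↦ ?_
    rw [Finset.mul_sum, ← Finset.sum_add_distrib]
    refine Finset.sum_congr rfl fun j _ ↦ ?_
    refine (congrArg _ (hII _ _)).trans ?_
    rw [mul_add, mul_left_comm]
    rfl
  rw [h5] at h8
  linarith

theorem contDiffAt_fst_comp_extChartAt_symm (hψ : S.IsSpacelikeHypersurface ψ) (q : M) :
    ContDiffAt ℝ 2 (fun y ↦ (ψ ((extChartAt (𝓡 m) q).symm y)).1) (extChartAt (𝓡 m) q q) := by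
  rw [← fst_writtenInExtChartAt]
  exact (contDiffAt_writtenInExtChartAt hψ q).fst.of_le (by decide)

/-- At a maximum of the time function of a maximal hypersurface, `ρ' ≥ 0`. -/
theorem deriv_ρ_nonneg_of_forall_le (hψ : S.IsMaximal ψ) (hm : 1 ≤ m) {q : M}
    (hq : ∀ q', (ψ q').1 ≤ (ψ q).1) : 0 ≤ deriv S.ρ (ψ q).1 := by
  have hmax : IsLocalMax (fun y ↦ (ψ ((extChartAt (𝓡 m) q).symm y)).1)
      (extChartAt (𝓡 m) q q) :=
    Eventually.of_forall fun y ↦ by simpa only [extChartAt_to_inv] using hq _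
  obtain ⟨K, hK, hsum⟩ := exists_posSemidef_sum_hessian_eq hψ hm hmax.fderiv_eq_zero
  have h := hsum.symm.trans_le (hK.sum_mul_apply_nonpos
    (ContinuousLinearMap.toLinearMap₁₂ (fderiv ℝ (fderiv ℝ _) _))
    (hmax.fderiv_fderiv_apply_self_nonpos
      (contDiffAt_fst_comp_extChartAt_symm hψ.toIsSpacelikeHypersurface q))
    fun i ↦ EuclideanSpace.single i 1)
  have hh := S.h_pos (ψ q).2
  have hρ := S.ρ_pos _ (hψ.mem q)
  have hm0 : (0 : ℝ) < m := by exact_mod_cast hm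
  by_contra! hneg
  -- If `ρ' < 0`, the trace `-m ρ' / (ρ h²)` would be positive, although the Hessian at a maximum is
  -- nonpositive.
  have := mul_neg_of_pos_of_neg hm0 (div_neg_of_neg_of_pos hneg (by positivity :
    0 < S.ρ (ψ q).1 * S.h (ψ q).2 ^ 2))
  linarith

/-- At a minimum of the time function of a maximal hypersurface, `ρ' ≤ 0`. -/
theorem deriv_ρ_nonpos_of_forall_ge (hψ : S.IsMaximal ψ) (hm : 1 ≤ m) {q : M}
    (hq : ∀ q', (ψ q).1 ≤ (ψ q').1) : deriv S.ρ (ψ q).1 ≤ 0 := by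
  have hmin : IsLocalMin (fun y ↦ (ψ ((extChartAt (𝓡 m) q).symm y)).1)
      (extChartAt (𝓡 m) q q) :=
    Eventually.of_forall fun y ↦ by simpa only [extChartAt_to_inv] using hq _
  obtain ⟨K, hK, hsum⟩ := exists_posSemidef_sum_hessian_eq hψ hm hmin.fderiv_eq_zero
  have h := (hK.sum_mul_apply_nonneg
    (ContinuousLinearMap.toLinearMap₁₂ (fderiv ℝ (fderiv ℝ _) _))
    (hmin.fderiv_fderiv_apply_self_nonneg
      (contDiffAt_fst_comp_extChartAt_symm hψ.toIsSpacelikeHypersurface q))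
    fun i ↦ EuclideanSpace.single i 1).trans_eq hsum
  have hh := S.h_pos (ψ q).2
  have hρ := S.ρ_pos _ (hψ.mem q)
  have hm0 : (0 : ℝ) < m := by exact_mod_cast hm
  by_contra! hneg
  have := mul_pos hm0 (div_pos hneg (by positivity : 0 < S.ρ (ψ q).1 * S.h (ψ q).2 ^ 2))
  linarith

/-- The sign of `ρ'` at the extreme times of `ψ` feeds the intermediate value theorem on the
interval `I`. The zero need not be a time attained by `ψ`. -/
theorem IsMaximal.exists_deriv_ρ_eq_zero [CompactSpace M] [Nonempty M] (hψ : S.IsMaximal ψ)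
    (hm : 1 ≤ m) : ∃ t ∈ S.I, deriv S.ρ t = 0 := by
  have hcont : Continuous fun q ↦ (ψ q).1 := hψ.contMDiff.continuous.fst
  obtain ⟨q₀, -, h₀⟩ := isCompact_univ.exists_isMinOn Set.univ_nonempty hcont.continuousOn
  obtain ⟨q₁, -, h₁⟩ := isCompact_univ.exists_isMaxOn Set.univ_nonempty hcont.continuousOn
  have hderiv : ContinuousOn (deriv S.ρ) S.I :=
    S.contDiffOn_ρ.continuousOn_deriv_of_isOpen S.isOpen_I (by decide)
  exact S.ordConnected_I.isPreconnected.intermediate_value (hψ.mem q₀) (hψ.mem q₁) hderiv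
    ⟨deriv_ρ_nonpos_of_forall_ge hψ hm fun q ↦ h₀ (Set.mem_univ q),
      deriv_ρ_nonneg_of_forall_le hψ hm fun q ↦ h₁ (Set.mem_univ q)⟩

end DoublyWarpedProduct

end

/-! ### The main theorem. -/

theorem theorem3p1 {m : ℕ} (hm : 1 ≤ m) {P : Type u} [TopologicalSpace P]
    [ChartedSpace (EuclideanSpace ℝ (Fin m)) P] [IsManifold (𝓡 m) ∞ P]
    [T2Space P] [ConnectedSpace P] [CompactSpace P] (S : DoublyWarpedProduct m P) :
    (S.AdmitsCompactMaximalHypersurface ↔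
      ∃ t₀ ∈ S.I, S.IsTotallyGeodesic (DoublyWarpedProduct.slice t₀)) ∧
    (S.AdmitsConnectedCompactMaximalHypersurface ↔
      ∃ t₀ ∈ S.I, S.IsTotallyGeodesic (DoublyWarpedProduct.slice t₀)) ∧
    (∀ t₀ ∈ S.I, S.IsTotallyGeodesic (DoublyWarpedProduct.slice t₀) ↔ deriv S.ρ t₀ = 0) := by
  have hslice : ∀ t₀ ∈ S.I,
      (S.IsTotallyGeodesic (DoublyWarpedProduct.slice t₀) ↔ deriv S.ρ t₀ = 0) :=
    fun t₀ ht ↦ S.isTotallyGeodesic_slice_iff hm ht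
  refine ⟨⟨?_, ?_⟩, ⟨?_, ?_⟩, hslice⟩
  · rintro ⟨M, _, _, ψ, _, _, _, _, hψ⟩
    obtain ⟨t, ht, h⟩ := hψ.exists_deriv_ρ_eq_zero hm
    exact ⟨t, ht, (hslice t ht).2 h⟩
  · rintro ⟨t, -, h⟩
    exact ⟨P, inferInstance, inferInstance, DoublyWarpedProduct.slice t, inferInstance,
      inferInstance, inferInstance, inferInstance, h.isMaximal⟩
  · rintro ⟨M, _, _, ψ, _, _, _, _, hψ⟩
    obtain ⟨t, ht, h⟩ := hψ.exists_deriv_ρ_eq_zero hm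
    exact ⟨t, ht, (hslice t ht).2 h⟩
  · rintro ⟨t, -, h⟩
    -- The slice is parametrized by `P`, which supplies both compactness and connectedness.
    exact ⟨P, inferInstance, inferInstance, DoublyWarpedProduct.slice t, inferInstance,
      inferInstance, inferInstance, inferInstance, h.isMaximal⟩
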